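/- **Theorem (Pick interpolation on the polydisk).** Let $d\ge 1$, let $z^{(j)}=(z^{(j)}_1,\dots,z^{(j)}_d)$, $j=1,\dots,n$, be points of the open unit polydisk $\mathbb D^d=\{z\in\mathbb C^d: |z_k|<1 \text{ for all } k\}$, and let $\lambda_1,\dots,\lambda_n\in\mathbb C$. For each $j$ let $\lambda_j^{1/d}$ denote a fixed (arbitrarily chosen) $d$-th root of $\lambda_j$. Suppose that for every $k=1,\dots,d$ the Pick matrix $$[K_k]_{pq}=\frac{1-\lambda_p^{1/d}\,\overline{\lambda_q^{1/d}}}{1-z^{(p)}_k\,\overline{z^{(q)}_k}},\qquad 1\le p,q\le n,$$ is (Hermitian) positive semidefinite. Then there exist functions $F_1,\dots,F_d$ on $\mathbb D^d$ such that, for every $k$, $F_k$ is an analytic function of the single coordinate $z_k$ (that is, $F_k(z)=f_k(z_k)$ for $z\in\mathbb D^d$, with $f_k$ analytic on the open unit disk), $\|F_k\|_\infty=\sup_{z\in\mathbb D^d}|F_k(z)|\le 1$, and $$F_k(z^{(j)})=\lambda_j^{1/d}\qquad\text{for all } j=1,\dots,n.$$ Moreover, the product $F=\prod_{k=1}^d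 F_k$ is analytic on $\mathbb D^d$, satisfies $\|F\|_\infty\le 1$, and $F(z^{(j)})=\lambda_j$ for all $j$. -/

import Mathlib

open scoped ENNReal ComplexConjugate ComplexOrder

/-- The open unit polydisk `𝔻^d` in `ℂ^d`. -/
def polydisk (d : ℕ) : Set (Fin d → ℂ) :=
  {z | ∀ k, ‖z k‖ < 1}

/-- The supremum norm over the polydisk, with values in `[0, ∞]`; it is finite exactly when the
function is bounded on the polydisk. -/
noncomputable def polydiskSupNorm {d : ℕ} (F : (Fin d → ℂ) → ℂ) : ℝ≥0∞ :=
  ⨆ z ∈ polydisk d, ‖F z‖ₑ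

/-- On the polydisk, `F` is an analytic function of the `k`-th coordinate alone. -/
def IsAnalyticInCoord {d : ℕ} (k : Fin d) (F : (Fin d → ℂ) → ℂ) : Prop :=
  ∃ f : ℂ → ℂ, AnalyticOnNhd ℂ f (Metric.ball 0 1) ∧ ∀ z ∈ polydisk d, F z = f (z k)

/-- The one-variable Pick matrix of the nodes `x p` and the targets `w p`. -/
noncomputable def pickMatrix {n : ℕ} (x w : Fin n → ℂ) : Matrix (Fin n) (Fin n) ℂ :=
  Matrix.of fun p q => (1 - w p * conj (w q)) / (1 - x p * conj (x q))

/-!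
The roots `r j` do not depend on the coordinate, so the theorem is the one-variable
Nevanlinna–Pick theorem applied in each coordinate: a function `f k` on the disk of sup norm at
most one with `f k (z j k) = r j` gives `F k x = f k (x k)`, and the product of the `F k` takes the
value `r j ^ d = lam j` at the `j`-th node.

The one-variable theorem, `exists_schur_interpolant`, is proved by Schur's algorithm, by induction
on the number of nodes. Let `x 0` be a node with target `w 0`; positivity gives `‖w 0‖ ≤ 1`. If
`‖w 0‖ = 1`, the `2 × 2` minors of the Pick matrix force all targets to be equal and a constant
interpolates. Otherwise move `x 0` and `w 0` to the origin by disk automorphisms; an interpolant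
vanishes at the origin, so by Schwarz it is `ζ * g ζ` with `g` again bounded by one, and `g` has to
solve a problem with one node fewer. Its Pick matrix is, up to diagonal congruence, the Schur
complement of the first entry of the given one, hence positive semidefinite
(`posSemidef_pickMatrix_diskMap`, `posSemidef_pickMatrix_div`). Repeated nodes carry equal targets,
again by a `2 × 2` minor, so the nodes may be taken distinct, as the division by `ζ` requires.
-/

/-! ### Disk automorphisms -/

/-- The automorphism `u ↦ (u - a) / (1 - conj a * u)` of the unit disk, for `‖a‖ < 1`; it
sends `a` to `0` and has inverse `diskMap (-a)`. -/
noncomputable def diskMap (a u : ℂ) : ℂ := (u - a) / (1 - conj a * u)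

theorem one_sub_conj_mul_ne_zero {a u : ℂ} (ha : ‖a‖ < 1) (hu : ‖u‖ ≤ 1) :
    1 - conj a * u ≠ 0 := by
  intro h
  have h1 : ‖conj a * u‖ = 1 := by rw [← sub_eq_zero.mp h, norm_one]
  rw [norm_mul, RCLike.norm_conj] at h1
  nlinarith [norm_nonneg a, norm_nonneg u]

theorem one_sub_mul_conj_ne_zero {a u : ℂ} (ha : ‖a‖ < 1) (hu : ‖u‖ ≤ 1) :
    1 - a * conj u ≠ 0 := by
  have := one_sub_conj_mul_ne_zero (a := conj a) (u := conj u)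
    (by simpa using ha) (by simpa using hu)
  simpa using this

theorem one_sub_diskMap_mul_conj {a u v : ℂ} (ha : ‖a‖ < 1) (hu : ‖u‖ ≤ 1) (hv : ‖v‖ ≤ 1) :
    1 - diskMap a u * conj (diskMap a v) =
      (1 - a * conj a) * (1 - u * conj v) / ((1 - conj a * u) * (1 - a * conj v)) := by
  have h1 := one_sub_conj_mul_ne_zero ha hu
  have h2 := one_sub_mul_conj_ne_zero ha hv
  simp only [diskMap, map_div₀, map_sub, map_mul, map_one, Complex.conj_conj]
  rw [div_mul_div_comm, eq_div_iff (mul_ne_zero h1 h2), sub_mul,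
    div_mul_cancel₀ _ (mul_ne_zero h1 h2)]
  ring

theorem one_sub_mul_conj_self (a : ℂ) : 1 - a * conj a = ((1 - ‖a‖ ^ 2 : ℝ) : ℂ) := by
  rw [Complex.mul_conj, Complex.normSq_eq_norm_sq]
  push_cast
  rfl

theorem one_sub_norm_diskMap_sq {a u : ℂ} (ha : ‖a‖ < 1) (hu : ‖u‖ ≤ 1) :
    1 - ‖diskMap a u‖ ^ 2 = (1 - ‖a‖ ^ 2) * (1 - ‖u‖ ^ 2) / ‖1 - conj a * u‖ ^ 2 := by
  have h := one_sub_diskMap_mul_conj ha hu hu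
  have h2 : (1 - conj a * u) * (1 - a * conj u) = ((‖1 - conj a * u‖ ^ 2 : ℝ) : ℂ) := by
    rw [← Complex.normSq_eq_norm_sq, ← Complex.mul_conj]
    simp
  rw [h2, one_sub_mul_conj_self, one_sub_mul_conj_self, one_sub_mul_conj_self] at h
  exact_mod_cast h

theorem norm_diskMap_le_one {a u : ℂ} (ha : ‖a‖ < 1) (hu : ‖u‖ ≤ 1) : ‖diskMap a u‖ ≤ 1 := by
  have h := one_sub_norm_diskMap_sq ha hu
  have : 0 ≤ (1 - ‖a‖ ^ 2) * (1 - ‖u‖ ^ 2) / ‖1 - conj a * u‖ ^ 2 := by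
    have h1 : 0 ≤ 1 - ‖a‖ ^ 2 := by nlinarith [norm_nonneg a]
    have h2 : 0 ≤ 1 - ‖u‖ ^ 2 := by nlinarith [norm_nonneg u]
    positivity
  nlinarith [norm_nonneg (diskMap a u)]

theorem norm_diskMap_lt_one {a u : ℂ} (ha : ‖a‖ < 1) (hu : ‖u‖ < 1) : ‖diskMap a u‖ < 1 := by
  have h := one_sub_norm_diskMap_sq ha hu.le
  have : 0 < (1 - ‖a‖ ^ 2) * (1 - ‖u‖ ^ 2) / ‖1 - conj a * u‖ ^ 2 := by
    have h1 : 0 < 1 - ‖a‖ ^ 2 := by nlinarith [norm_nonneg a]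
    have h2 : 0 < 1 - ‖u‖ ^ 2 := by nlinarith [norm_nonneg u]
    have h3 : 0 < ‖1 - conj a * u‖ := norm_pos_iff.mpr (one_sub_conj_mul_ne_zero ha hu.le)
    positivity
  nlinarith [norm_nonneg (diskMap a u)]

theorem diskMap_neg_diskMap {a u : ℂ} (ha : ‖a‖ < 1) (hu : ‖u‖ ≤ 1) :
    diskMap (-a) (diskMap a u) = u := by
  have h1 := one_sub_conj_mul_ne_zero ha hu
  have h2 := one_sub_conj_mul_ne_zero (a := -a) (by simpa using ha) (norm_diskMap_le_one ha hu)
  have h3 : diskMap a u * (1 - conj a * u) = u - a := div_mul_cancel₀ _ h1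
  rw [diskMap, div_eq_iff h2, map_neg]
  linear_combination h3

@[simp] theorem diskMap_self (a : ℂ) : diskMap a a = 0 := by simp [diskMap]

theorem diskMap_injective {a u v : ℂ} (ha : ‖a‖ < 1) (hu : ‖u‖ ≤ 1) (hv : ‖v‖ ≤ 1)
    (h : diskMap a u = diskMap a v) : u = v := by
  rw [← diskMap_neg_diskMap ha hu, h, diskMap_neg_diskMap ha hv]

theorem analyticAt_diskMap {a u : ℂ} (ha : ‖a‖ < 1) (hu : ‖u‖ ≤ 1) :
    AnalyticAt ℂ (diskMap a) u :=
  (analyticAt_id.sub analyticAt_const).div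
    (analyticAt_const.sub (analyticAt_const.mul analyticAt_id))
    (one_sub_conj_mul_ne_zero ha hu)

/-! ### Minors of the Pick matrix -/

theorem norm_target_le_one {n : ℕ} {x w : Fin n → ℂ} (hx : ∀ j, ‖x j‖ < 1)
    (h : (pickMatrix x w).PosSemidef) (p : Fin n) : ‖w p‖ ≤ 1 := by
  have h0 := h.diag_nonneg (i := p)
  have hx' : 0 < 1 - ‖x p‖ ^ 2 := by nlinarith [norm_nonneg (x p), hx p]
  simp only [pickMatrix, Matrix.of_apply, one_sub_mul_conj_self] at h0
  rw [← Complex.ofReal_div, Complex.zero_le_real] at h0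
  have := mul_nonneg h0 hx'.le
  rw [div_mul_cancel₀ _ hx'.ne'] at this
  nlinarith [norm_nonneg (w p)]

/-- The `2 × 2` principal minors of a positive semidefinite Pick matrix are nonnegative. -/
theorem pickMatrix_minor_le {n : ℕ} {x w : Fin n → ℂ}
    (h : (pickMatrix x w).PosSemidef) (p q : Fin n) :
    ‖1 - w p * conj (w q)‖ ^ 2 / ‖1 - x p * conj (x q)‖ ^ 2 ≤
      (1 - ‖w p‖ ^ 2) / (1 - ‖x p‖ ^ 2) * ((1 - ‖w q‖ ^ 2) / (1 - ‖x q‖ ^ 2)) := by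
  have hdet := (h.submatrix ![p, q]).det_nonneg
  have hc : (1 - w p * conj (w q)) / (1 - x p * conj (x q)) *
      ((1 - w q * conj (w p)) / (1 - x q * conj (x p))) =
      ((‖1 - w p * conj (w q)‖ ^ 2 / ‖1 - x p * conj (x q)‖ ^ 2 : ℝ) : ℂ) := by
    have h1 : ∀ a b : ℂ, (1 - a * conj b) * (1 - b * conj a) =
        ((‖1 - a * conj b‖ ^ 2 : ℝ) : ℂ) := by
      intro a b
      rw [← Complex.normSq_eq_norm_sq, ← Complex.mul_conj]
      simp [mul_comm]
    rw [div_mul_div_comm, h1, h1, Complex.ofReal_div]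
  rw [Matrix.det_fin_two] at hdet
  simp only [pickMatrix, Matrix.submatrix_apply, Matrix.of_apply, Matrix.cons_val_zero,
    Matrix.cons_val_one] at hdet
  rw [hc, one_sub_mul_conj_self, one_sub_mul_conj_self, one_sub_mul_conj_self,
    one_sub_mul_conj_self] at hdet
  have : (0 : ℝ) ≤ (1 - ‖w p‖ ^ 2) / (1 - ‖x p‖ ^ 2) * ((1 - ‖w q‖ ^ 2) / (1 - ‖x q‖ ^ 2)) -
      ‖1 - w p * conj (w q)‖ ^ 2 / ‖1 - x p * conj (x q)‖ ^ 2 := by exact_mod_cast hdet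
  linarith

theorem norm_one_sub_mul_conj_sq (a b : ℂ) :
    ‖1 - a * conj b‖ ^ 2 = (1 - ‖a‖ ^ 2) * (1 - ‖b‖ ^ 2) + ‖a - b‖ ^ 2 := by
  simp only [← Complex.normSq_eq_norm_sq, Complex.normSq_apply, Complex.sub_re, Complex.sub_im,
    Complex.mul_re, Complex.mul_im, Complex.conj_re, Complex.conj_im, Complex.one_re,
    Complex.one_im]
  ring

theorem target_eq_of_norm_eq_one {n : ℕ} {x w : Fin n → ℂ} (hx : ∀ j, ‖x j‖ < 1)
    (h : (pickMatrix x w).PosSemidef) {p : Fin n} (hp : ‖w p‖ = 1) (q : Fin n) : w q = w p := by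
  have hm := pickMatrix_minor_le h p q
  rw [norm_one_sub_mul_conj_sq (w p), hp] at hm
  have h0 : 0 < ‖1 - x p * conj (x q)‖ ^ 2 := by
    have := norm_pos_iff.mpr (one_sub_mul_conj_ne_zero (hx p) (hx q).le)
    positivity
  norm_num at hm
  rw [div_le_iff₀ h0, zero_mul] at hm
  have : ‖w p - w q‖ = 0 := by nlinarith [norm_nonneg (w p - w q)]
  exact (sub_eq_zero.mp (norm_eq_zero.mp this)).symm

theorem target_eq_of_node_eq {n : ℕ} {x w : Fin n → ℂ} (hx : ∀ j, ‖x j‖ < 1)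
    (h : (pickMatrix x w).PosSemidef) {p q : Fin n} (hpq : x p = x q) : w p = w q := by
  have hm := pickMatrix_minor_le h p q
  have h0 : 0 < 1 - ‖x q‖ ^ 2 := by nlinarith [norm_nonneg (x q), hx q]
  rw [norm_one_sub_mul_conj_sq, norm_one_sub_mul_conj_sq, hpq, sub_self, norm_zero,
    div_mul_div_comm, zero_pow two_ne_zero, add_zero,
    div_le_div_iff_of_pos_right (mul_pos h0 h0)] at hm
  have : ‖w p - w q‖ = 0 := by nlinarith [norm_nonneg (w p - w q)]
  exact sub_eq_zero.mp (norm_eq_zero.mp this)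

/-! ### Schur's algorithm -/

/-- Disk automorphisms applied to the nodes and to the targets change the Pick matrix by a diagonal
congruence and a positive factor. -/
theorem posSemidef_pickMatrix_diskMap {n : ℕ} {x w : Fin n → ℂ} {a b : ℂ} (hx : ∀ j, ‖x j‖ < 1)
    (ha : ‖a‖ < 1) (hb : ‖b‖ < 1) (h : (pickMatrix x w).PosSemidef) :
    (pickMatrix (fun i => diskMap a (x i)) (fun i => diskMap b (w i))).PosSemidef := by
  have hw := norm_target_le_one hx h
  have ht : (0 : ℂ) ≤ ((1 - ‖b‖ ^ 2) / (1 - ‖a‖ ^ 2) : ℝ) := by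
    rw [Complex.zero_le_real]
    exact div_nonneg (by nlinarith [norm_nonneg b]) (by nlinarith [norm_nonneg a])
  convert (h.mul_mul_conjTranspose_same
    (Matrix.diagonal fun i => (1 - conj a * x i) / (1 - conj b * w i))).smul ht using 1
  ext i j
  have h1 := one_sub_conj_mul_ne_zero ha (hx i).le
  have h2 := one_sub_mul_conj_ne_zero ha (hx j).le
  have h3 := one_sub_conj_mul_ne_zero hb (hw i)
  have h4 := one_sub_mul_conj_ne_zero hb (hw j)
  have h5 := one_sub_mul_conj_ne_zero (hx i) (hx j).le
  have h6 := one_sub_mul_conj_ne_zero ha ha.le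
  simp only [pickMatrix, Matrix.of_apply, Matrix.smul_apply, Matrix.diagonal_conjTranspose,
    Matrix.mul_diagonal, Matrix.diagonal_mul, Pi.star_apply, RCLike.star_def, map_div₀, map_sub,
    map_one, map_mul, Complex.conj_conj, smul_eq_mul, Complex.ofReal_div,
    ← one_sub_mul_conj_self]
  rw [one_sub_diskMap_mul_conj hb (hw i) (hw j), one_sub_diskMap_mul_conj ha (hx i).le (hx j).le]
  simp only [div_eq_mul_inv, mul_inv, inv_inv]
  ring

/-- One step of Schur's algorithm at the origin: the reduced Pick matrix is a diagonal congruence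
of the Schur complement of the first entry, whose row and column consist of ones. -/
theorem posSemidef_pickMatrix_div {n : ℕ} {x w : Fin (n + 1) → ℂ} (hx : ∀ j, ‖x j‖ < 1)
    (hx0 : x 0 = 0) (hw0 : w 0 = 0) (hne : ∀ i : Fin n, x i.succ ≠ 0)
    (h : (pickMatrix x w).PosSemidef) :
    (pickMatrix (fun i : Fin n => x i.succ) (fun i => w i.succ / x i.succ)).PosSemidef := by
  -- The `i`-th row of the congruence subtracts row `0` from row `i + 1` and divides by the node.
  convert h.mul_mul_conjTranspose_same (Matrix.of fun (i : Fin n) =>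
    (Fin.cons (-(x i.succ)⁻¹) (Pi.single i (x i.succ)⁻¹) : Fin (n + 1) → ℂ)) using 1
  ext i j
  have h1 := hne i
  have h2 : conj (x j.succ) ≠ 0 := (map_ne_zero _).mpr (hne j)
  have h5 := one_sub_mul_conj_ne_zero (hx i.succ) (hx j.succ).le
  simp only [Matrix.mul_apply, Matrix.conjTranspose_apply, Fin.sum_univ_succ, Matrix.of_apply,
    Fin.cons_zero, Fin.cons_succ, Pi.single_apply, pickMatrix, hx0, hw0, ite_mul, zero_mul,
    Finset.sum_ite_eq', Finset.mem_univ, if_true, RCLike.star_def,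
    apply_ite conj, map_zero, mul_ite, mul_zero, map_neg, map_inv₀, map_div₀]
  field_simp
  ring

/-- The Nevanlinna–Pick theorem for distinct nodes. -/
theorem exists_schur_interpolant_of_injective {n : ℕ} {x w : Fin n → ℂ} (hx : ∀ j, ‖x j‖ < 1)
    (hinj : Function.Injective x) (h : (pickMatrix x w).PosSemidef) :
    ∃ f : ℂ → ℂ, AnalyticOnNhd ℂ f (Metric.ball 0 1) ∧
      (∀ u ∈ Metric.ball (0 : ℂ) 1, ‖f u‖ ≤ 1) ∧ ∀ j, f (x j) = w j := by
  induction n with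
  | zero => exact ⟨0, analyticOnNhd_const, by simp, fun j => j.elim0⟩
  | succ n ih =>
    rcases (norm_target_le_one hx h 0).eq_or_lt with hw | hw
    · exact ⟨fun _ => w 0, analyticOnNhd_const, fun _ _ => hw.le,
        fun j => (target_eq_of_norm_eq_one hx h hw j).symm⟩
    have hb : ∀ u ∈ Metric.ball (0 : ℂ) 1, diskMap (x 0) u ∈ Metric.ball (0 : ℂ) 1 := by
      intro u hu
      rw [mem_ball_zero_iff] at hu ⊢
      exact norm_diskMap_lt_one (hx 0) hu
    have hne : ∀ i : Fin n, diskMap (x 0) (x i.succ) ≠ 0 := by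
      intro i he
      rw [← diskMap_self (x 0)] at he
      exact Fin.succ_ne_zero i (hinj (diskMap_injective (hx 0) (hx _).le (hx 0).le he))
    have hP := posSemidef_pickMatrix_div (x := fun j => diskMap (x 0) (x j))
      (w := fun j => diskMap (w 0) (w j)) (fun j => norm_diskMap_lt_one (hx 0) (hx j))
      (diskMap_self (x 0)) (diskMap_self (w 0)) hne
      (posSemidef_pickMatrix_diskMap hx (hx 0) hw h)
    obtain ⟨g, hga, hgb, hgi⟩ := ih
      (x := fun i => diskMap (x 0) (x i.succ))
      (w := fun i => diskMap (w 0) (w i.succ) / diskMap (x 0) (x i.succ))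
      (fun i => norm_diskMap_lt_one (hx 0) (hx i.succ))
      (fun i j hij => Fin.succ_injective n
        (hinj (diskMap_injective (hx 0) (hx i.succ).le (hx j.succ).le hij)))
      hP
    have hw' : ‖-w 0‖ < 1 := by rwa [norm_neg]
    have hprod : ∀ u ∈ Metric.ball (0 : ℂ) 1, ‖diskMap (x 0) u * g (diskMap (x 0) u)‖ ≤ 1 := by
      intro u hu
      rw [norm_mul]
      exact mul_le_one₀ (mem_ball_zero_iff.mp (hb u hu)).le (norm_nonneg _) (hgb _ (hb u hu))
    refine ⟨fun u => diskMap (-w 0) (diskMap (x 0) u * g (diskMap (x 0) u)), ?_, ?_, ?_⟩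
    · intro u hu
      have h1 : AnalyticAt ℂ (diskMap (x 0)) u :=
        analyticAt_diskMap (hx 0) (mem_ball_zero_iff.mp hu).le
      exact AnalyticAt.fun_comp (g := diskMap (-w 0)) (analyticAt_diskMap hw' (hprod u hu))
        (h1.fun_mul ((hga _ (hb u hu)).fun_comp h1))
    · exact fun u hu => norm_diskMap_le_one hw' (hprod u hu)
    · intro j
      refine Fin.cases ?_ (fun i => ?_) j
      · simp [diskMap]
      · have := hgi i
        simp only at this ⊢
        rw [this, mul_div_cancel₀ _ (hne i), diskMap_neg_diskMap hw (norm_target_le_one hx h _)]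

/-- The sufficiency half of the Nevanlinna–Pick theorem in the disk; the nodes may repeat. -/
theorem exists_schur_interpolant {n : ℕ} {x w : Fin n → ℂ} (hx : ∀ j, ‖x j‖ < 1)
    (h : (pickMatrix x w).PosSemidef) :
    ∃ f : ℂ → ℂ, AnalyticOnNhd ℂ f (Metric.ball 0 1) ∧
      (∀ u ∈ Metric.ball (0 : ℂ) 1, ‖f u‖ ≤ 1) ∧ ∀ j, f (x j) = w j := by
  let e := Finite.equivFin (Set.range x)
  -- `s` chooses one index for each value of `x`.
  let s : Fin (Nat.card (Set.range x)) → Fin n := fun a => (e.symm a).2.choose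
  have hs : ∀ a, x (s a) = e.symm a := fun a => (e.symm a).2.choose_spec
  obtain ⟨f, hfa, hfb, hfi⟩ := exists_schur_interpolant_of_injective
    (x := x ∘ s) (w := w ∘ s) (fun a => hx (s a))
    (fun a b hab => e.symm.injective (Subtype.ext (by rw [← hs, ← hs]; exact hab)))
    (h.submatrix s)
  refine ⟨f, hfa, hfb, fun j => ?_⟩
  obtain ⟨a, ha⟩ : ∃ a, x (s a) = x j :=
    ⟨e ⟨x j, Set.mem_range_self j⟩, by rw [hs, Equiv.symm_apply_apply]⟩
  rw [← target_eq_of_node_eq hx h ha, ← ha]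
  exact hfi a

/-! ### The polydisk -/

theorem polydiskSupNorm_le_one {d : ℕ} {F : (Fin d → ℂ) → ℂ}
    (h : ∀ x ∈ polydisk d, ‖F x‖ ≤ 1) : polydiskSupNorm F ≤ 1 := by
  refine iSup₂_le fun x hx => ?_
  rw [← ofReal_norm, ← ENNReal.ofReal_one]
  exact ENNReal.ofReal_le_ofReal (h x hx)

/-- Here `r j` is a `d`-th root `λ_j^{1/d}` of `lam j`; the choice of the roots is arbitrary. -/
theorem mainTheorem7 (d n : ℕ) (hd : 1 ≤ d)
    (z : Fin n → Fin d → ℂ) (hz : ∀ j, z j ∈ polydisk d)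
    (lam r : Fin n → ℂ) (hr : ∀ j, r j ^ d = lam j)
    (hpick : ∀ k : Fin d, (pickMatrix (fun p => z p k) r).PosSemidef) :
    ∃ F : Fin d → (Fin d → ℂ) → ℂ,
      (∀ k, IsAnalyticInCoord k (F k) ∧ polydiskSupNorm (F k) ≤ 1 ∧ ∀ j, F k (z j) = r j) ∧
      (AnalyticOnNhd ℂ (fun x => ∏ k, F k x) (polydisk d) ∧
        polydiskSupNorm (fun x => ∏ k, F k x) ≤ 1 ∧
        ∀ j, ∏ k, F k (z j) = lam j) := by
  choose f hfa hfb hfi using fun k => exists_schur_interpolant (fun j => hz j k) (hpick k)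
  have hmem : ∀ x ∈ polydisk d, ∀ k, x k ∈ Metric.ball (0 : ℂ) 1 :=
    fun x hx k => mem_ball_zero_iff.mpr (hx k)
  have hb : ∀ k, ∀ x ∈ polydisk d, ‖f k (x k)‖ ≤ 1 := fun k x hx => hfb k _ (hmem x hx k)
  refine ⟨fun k x => f k (x k), fun k => ⟨⟨f k, hfa k, fun _ _ => rfl⟩,
    polydiskSupNorm_le_one (hb k), hfi k⟩, ?_, ?_, ?_⟩
  · intro x hx
    refine Finset.analyticAt_fun_prod _ fun k _ => ?_
    exact AnalyticAt.fun_comp (f := fun x : Fin d → ℂ => x k) (hfa k _ (hmem x hx k))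
      ((ContinuousLinearMap.proj (R := ℂ) (φ := fun _ : Fin d => ℂ) k).analyticAt x)
  · refine polydiskSupNorm_le_one fun x hx => ?_
    rw [norm_prod]
    exact Finset.prod_le_one (fun _ _ => norm_nonneg _) fun k _ => hb k x hx
  · intro j
    simp only [hfi, Finset.prod_const, Finset.card_univ, Fintype.card_fin, hr]
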